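/- **Setting.** A *bumpless pipe dream* of size $n$ is a tiling $B$ of the $n\times n$ grid (matrix coordinates) by the six tiles blank, cross, horizontal, vertical, r-elbow (joining the south and east sides) and j-elbow (joining the west and north sides), whose strands form $n$ pipes that travel north and east, one entering at the bottom of each column and one leaving at the right end of each row. Write $j\to i$ for a pipe that enters in column $j$ and leaves in row $i$. For $w\in S_n$, let $\mathrm{BPD}(w)$ be the set of bumpless pipe dreams of size $n$ whose pipes are $w(i)\to i$ for $1\le i\le n$ (pipes go straight through each cross, and two pipes may cross several times). $B$ is *reduced* if no two pipes cross more than once. A pipe $j\to i$ of $B$ is *removable* if the tile at $(i,j)$ is an r-elbow and it is the only r-elbow in row $i$ and the only one in column $j$; $B$ is *minimal* if it has no removable pipe. Let $\mathrm{mbpd}(u)$ be the set of minimal reduced elements of $\mathrm{BPD}(u)$. Let $w\in S_n$ and let $v\subseteq w$ be a subword of size $m$, $0\le m\le n$, at positions $s_1<\dots<s_m$ and with entries $t_1<\dots<t_m$ in increasing order. Let $u:=\mathrm{perm}(v)\in S_m$ be the standardization of $v$, i.e. $w(s_i)=t_{u(i)}$ for all $i$. Let $\mathrm{BPD}(w;v)$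 be the set of $B\in\mathrm{BPD}(w)$ whose removable pipes are exactly the pipes $w(x)\to x$ with $x\notin\{s_1,\dots,s_m\}$, and let $\mathrm{bpd}(w;v)$ be the set of its reduced elements. For $B\in\mathrm{BPD}(w;v)$ let $\varphi_v^w(B)$ be the $m\times m$ tiling obtained from $B$ by erasing all its removable pipes and then deleting, and closing up, all rows except $s_1,\dots,s_m$ and all columns except $t_1,\dots,t_m$. **Proposition.** If $w$ is $1243$-avoiding, then $$\varphi_v^w(\mathrm{bpd}(w;v))=\mathrm{mbpd}(u),$$ and $\varphi_v^w$ restricts to a bijection $\mathrm{bpd}(w;v)\to\mathrm{mbpd}(u)$. -/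

import Mathlib

namespace BumplessPipeDream

/-- The six tiles. Pipes travel north and east: in the r-elbow a pipe turns from north to east
(it joins the south and east sides), in the j-elbow from east to north (it joins the west and
north sides). -/
inductive Tile
  | blank
  | cross
  | horizontal
  | vertical
  | rElbow
  | jElbow

/-- Does a strand of the tile meet its north side? -/
def Tile.north : Tile → Bool
  | .cross | .vertical | .jElbow => true
  | _ => false

/-- Does a strand of the tile meet its south side? -/
def Tile.south : Tile → Bool
  | .cross | .vertical | .rElbow => true
  | _ => false

/-- Does a strand of the tile meet its east side? -/
def Tile.east : Tile → Bool
  | .cross | .horizontal | .rElbow => true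
  | _ => false

/-- Does a strand of the tile meet its west side? -/
def Tile.west : Tile → Bool
  | .cross | .horizontal | .jElbow => true
  | _ => false

/-- The direction in which a pipe is moving. -/
inductive Dir
  | north
  | east

/-- The direction in which a pipe leaves a tile, given the direction in which it enters it
(`none` if no strand of the tile starts at that side). -/
def Tile.out : Tile → Dir → Option Dir
  | .cross, d => some d
  | .horizontal, .east => some .east
  | .vertical, .north => some .north
  | .rElbow, .north => some .east
  | .jElbow, .east => some .north
  | _, _ => none

/-- A filling of the `k × l` grid by tiles; rows are numbered from top to bottom and columns from
left to right, as for matrices. -/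
abbrev Tiling (k l : ℕ) := Fin k → Fin l → Tile

/-- `B` is a bumpless pipe dream of size `n`: strands of neighbouring tiles fit together, a pipe
enters at the bottom of each column, a pipe leaves at the right end of each row, and no pipe
meets the left or the top border. -/
structure IsBPD {n : ℕ} (B : Tiling n n) : Prop where
  match_row : ∀ a b b' : Fin n, b'.val = b.val + 1 → (B a b).east = (B a b').west
  match_col : ∀ a a' b : Fin n, a'.val = a.val + 1 → (B a b).south = (B a' b).north
  left_border : ∀ a b : Fin n, b.val = 0 → (B a b).west = false
  top_border : ∀ a b : Fin n, a.val = 0 → (B a b).north = false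
  right_border : ∀ a b : Fin n, b.val + 1 = n → (B a b).east = true
  bottom_border : ∀ a b : Fin n, a.val + 1 = n → (B a b).south = true

/-- `Enters B j a b d`: the pipe of `B` that starts at the bottom of column `j` enters the cell
in row `a` and column `b` moving in direction `d`. -/
inductive Enters {n : ℕ} (B : Tiling n n) (j : Fin n) : Fin n → Fin n → Dir → Prop
  | start (a : Fin n) : a.val + 1 = n → Enters B j a j .north
  | goNorth (a a' b : Fin n) (d : Dir) : Enters B j a b d → (B a b).out d = some .north →
      a'.val + 1 = a.val → Enters B j a' b .north
  | goEast (a b b' : Fin n) (d : Dir) : Enters B j a b d → (B a b).out d = some .east →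
      b'.val = b.val + 1 → Enters B j a b' .east

/-- `j → i` is a pipe of `B`: the pipe that starts at the bottom of column `j` leaves the grid at
the right end of row `i`. -/
def IsPipe {n : ℕ} (B : Tiling n n) (j i : Fin n) : Prop :=
  ∃ (b : Fin n) (d : Dir), b.val + 1 = n ∧ Enters B j i b d ∧ (B i b).out d = some .east

/-- The bumpless pipe dreams (reduced or not) with permutation `w`. -/
def BPD {n : ℕ} (w : Equiv.Perm (Fin n)) : Set (Tiling n n) :=
  {B | IsBPD B ∧ ∀ i, IsPipe B (w i) i}

/-- The pipes starting in columns `j` and `j'` cross each other in the cell `(a, b)`. -/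
def CrossAt {n : ℕ} (B : Tiling n n) (j j' a b : Fin n) : Prop :=
  B a b = .cross ∧
    ((Enters B j a b .north ∧ Enters B j' a b .east) ∨
      (Enters B j a b .east ∧ Enters B j' a b .north))

/-- No two distinct pipes cross more than once. -/
def IsReduced {n : ℕ} (B : Tiling n n) : Prop :=
  ∀ j j' : Fin n, j ≠ j' → {c : Fin n × Fin n | CrossAt B j j' c.1 c.2}.Subsingleton

/-- The pipe `j → i` of `B` is removable: the cell `(i, j)` is an r-elbow, and it is the only
r-elbow in row `i` and the only one in column `j`. -/
def IsRemovable {n : ℕ} (B : Tiling n n) (j i : Fin n) : Prop :=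
  IsPipe B j i ∧ B i j = .rElbow ∧
    (∀ b, B i b = .rElbow → b = j) ∧ (∀ a, B a j = .rElbow → a = i)

/-- `B` is minimal: it has no removable pipe. -/
def IsMinimal {n : ℕ} (B : Tiling n n) : Prop :=
  ∀ j i : Fin n, ¬ IsRemovable B j i

/-- The minimal reduced bumpless pipe dreams with permutation `u`. -/
def mbpd {m : ℕ} (u : Equiv.Perm (Fin m)) : Set (Tiling m m) :=
  {B | B ∈ BPD u ∧ IsMinimal B ∧ IsReduced B}

/-! A subword `v ⊆ w` of size `m` is given by the increasing sequence `s` of its positions, so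
that `v` is the word `w (s 0), …, w (s (m - 1))`. -/

/-- The word of the subword of `w` at the positions `s`. -/
def subword {n m : ℕ} (w : Equiv.Perm (Fin n)) (s : Fin m ↪o Fin n) : Fin m → Fin n :=
  fun i => w (s i)

/-- The entries of a word in increasing order. -/
def sortedEntries {n m : ℕ} (v : Fin m → Fin n) : Fin m → Fin n :=
  v ∘ Tuple.sort v

/-- The standardization of a word `v` with distinct entries: the permutation `u` such that `v i`
is the `u i`-th smallest entry of `v`. -/
def perm {n m : ℕ} (v : Fin m → Fin n) : Equiv.Perm (Fin m) :=
  (Tuple.sort v)⁻¹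

theorem sortedEntries_perm {n m : ℕ} (v : Fin m → Fin n) (i : Fin m) :
    sortedEntries v (perm v i) = v i := by
  simp [sortedEntries, perm]

theorem sortedEntries_strictMono {n m : ℕ} (w : Equiv.Perm (Fin n)) (s : Fin m ↪o Fin n) :
    StrictMono (sortedEntries (subword w s)) :=
  (Tuple.monotone_sort _).strictMono_of_injective
    ((w.injective.comp s.injective).comp (Tuple.sort (subword w s)).injective)

/-- `w` avoids the pattern `p`: no subword of `w` standardizes to `p`. -/
def Avoids {n k : ℕ} (w : Equiv.Perm (Fin n)) (p : Equiv.Perm (Fin k)) : Prop :=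
  ∀ s : Fin k ↪o Fin n, perm (subword w s) ≠ p

/-- The permutation `1243`. -/
def perm1243 : Equiv.Perm (Fin 4) := Equiv.swap 2 3

/-- `BPD(w; v)`: the bumpless pipe dreams with permutation `w` whose removable pipes are exactly
those `w x → x` for which `w x` is not an entry of the subword `v` at the positions `s`. -/
def BPDsub {n m : ℕ} (w : Equiv.Perm (Fin n)) (s : Fin m ↪o Fin n) : Set (Tiling n n) :=
  {B | B ∈ BPD w ∧ ∀ j i : Fin n, IsRemovable B j i ↔ j = w i ∧ i ∉ Set.range s}

/-- `bpd(w; v)`: the reduced elements of `BPD(w; v)`. -/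
def bpdsub {n m : ℕ} (w : Equiv.Perm (Fin n)) (s : Fin m ↪o Fin n) : Set (Tiling n n) :=
  {B | B ∈ BPDsub w s ∧ IsReduced B}

open Classical in
/-- What remains of a tile after its strand starting at the south side is erased (if `p`) and its
strand starting at the west side is erased (if `q`). -/
noncomputable def Tile.erase (T : Tile) (p q : Prop) : Tile :=
  match T with
  | .blank => .blank
  | .cross =>
      if p then (if q then .blank else .horizontal) else (if q then .vertical else .cross)
  | .vertical => if p then .blank else .vertical
  | .rElbow => if p then .blank else .rElbow
  | .horizontal => if q then .blank else .horizontal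
  | .jElbow => if q then .blank else .jElbow

/-- Erase from `B` the pipes that start in the columns of the set `Y`. -/
noncomputable def erasePipes {n : ℕ} (B : Tiling n n) (Y : Set (Fin n)) : Tiling n n :=
  fun a b =>
    (B a b).erase (∃ j ∈ Y, Enters B j a b .north) (∃ j ∈ Y, Enters B j a b .east)

/-- Delete all rows except those at the positions `s` and close the gaps. -/
def contractRows {n m l : ℕ} (s : Fin m → Fin n) (B : Tiling n l) : Tiling m l :=
  fun i b => B (s i) b

/-- Delete all columns except those at the positions `t` and close the gaps. -/
def contractCols {k n m : ℕ} (t : Fin m → Fin n) (B : Tiling k n) : Tiling k m :=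
  fun a j => B a (t j)

/-- The map `φ_v^w`: erase the pipes `w x → x` with `x` not a position of `v`, then contract the
rows of these `x`, then contract the columns of these `w x`. -/
noncomputable def phi {n m : ℕ} (w : Equiv.Perm (Fin n)) (s : Fin m ↪o Fin n) (B : Tiling n n) :
    Tiling m m :=
  contractCols (sortedEntries (subword w s))
    (contractRows s (erasePipes B {y | ∃ x, x ∉ Set.range s ∧ y = w x}))

end BumplessPipeDream

namespace BumplessPipeDream

/-! A removable pipe `w x → x` is a hook: it goes straight up column `w x`, turns in the cell `(x, w
x)` and goes straight along row `x`. That row and that column contain no other elbow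
(`Hooked.of_mem_BPDsub`). Hence the removed pipes miss every kept cell, so `phi` merely restricts to
a submatrix (`Hooked.phi_apply`), and the deleted rows and columns only carry strands straight
across. Entries, pipes, removability and crossings of kept pipes therefore agree before and after
contraction. A tiling with hooks is recovered from its submatrix by `Hooked.eq_of_submatrix_eq`, and
hooks can be inserted into any bumpless pipe dream by `IsBPD.exists_hooked`. All this holds for
every `w` and without reducedness.

Pattern avoidance enters only to show that inserting hooks creates no double crossing. A pipe meets
each leg of a hook at most once. If `w p → p` crosses both legs of the hook of `x`, then `p < x` and
`w p < w x`, and between the two crossings it turns north at a j-elbow strictly south-east of the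
corner. An extremal j-elbow in that quadrant yields pipes `w i → i` and `w i' → i'` with `x < i <
i'` and `w x < w i' < w i` (`IsBPD.exists_inversion`). The positions `p, x, i, i'` then form a
`1243` (`Hooked.not_cross_twice`). -/

theorem Tile.ext_sides {S T : Tile} (hn : S.north = T.north) (hs : S.south = T.south)
    (he : S.east = T.east) (hw : S.west = T.west) : S = T := by
  cases S <;> cases T <;> simp_all [Tile.north, Tile.south, Tile.east, Tile.west]

/-- A tile is determined by its north and west sides and by whether it is an elbow. -/
theorem Tile.ext_elbow {S T : Tile} (hn : S.north = T.north) (hw : S.west = T.west)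
    (hr : S = .rElbow ↔ T = .rElbow) (hj : S = .jElbow ↔ T = .jElbow) : S = T := by
  cases S <;> cases T <;> simp_all [Tile.north, Tile.west]

theorem Tile.north_eq_south {T : Tile} (hr : T ≠ .rElbow) (hj : T ≠ .jElbow) :
    T.north = T.south := by
  cases T <;> simp_all [Tile.north, Tile.south]

theorem Tile.west_eq_east {T : Tile} (hr : T ≠ .rElbow) (hj : T ≠ .jElbow) :
    T.west = T.east := by
  cases T <;> simp_all [Tile.west, Tile.east]

/-! ### Local rules for strands in a tile. -/

theorem Tile.out_injective {T : Tile} {d d' e : Dir} (h : T.out d = some e)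
    (h' : T.out d' = some e) : d = d' := by
  cases T <;> cases d <;> cases d' <;> simp_all [Tile.out]

theorem Tile.south_of_north {T : Tile} (h : T.north = true) (hj : T ≠ .jElbow) :
    T.south = true ∧ T.out .north = some .north := by
  cases T <;> simp_all [Tile.north, Tile.south, Tile.out]

theorem Tile.east_of_west {T : Tile} (h : T.west = true) (hj : T ≠ .jElbow) :
    T.east = true ∧ T.out .east = some .east := by
  cases T <;> simp_all [Tile.west, Tile.east, Tile.out]

theorem Tile.out_of_north {T : Tile} (h : T.north = true) :
    (T.south = true ∧ T.out .north = some .north) ∨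
      (T.west = true ∧ T.out .east = some .north) := by
  cases T <;> simp_all [Tile.north, Tile.south, Tile.west, Tile.out]

theorem Tile.out_of_east {T : Tile} (h : T.east = true) :
    (T.south = true ∧ T.out .north = some .east) ∨
      (T.west = true ∧ T.out .east = some .east) := by
  cases T <;> simp_all [Tile.east, Tile.south, Tile.west, Tile.out]

theorem Tile.north_of_out {T : Tile} {d : Dir} (h : T.out d = some .north) :
    T.north = true := by
  cases T <;> cases d <;> simp_all [Tile.out, Tile.north]

theorem Tile.east_of_out {T : Tile} {d : Dir} (h : T.out d = some .east) :
    T.east = true := by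
  cases T <;> cases d <;> simp_all [Tile.out, Tile.east]

theorem Tile.eq_jElbow_of_out {T : Tile} (h : T.out .east = some .north) : T = .jElbow := by
  cases T <;> simp_all [Tile.out]

theorem Tile.eq_rElbow_of_out {T : Tile} (h : T.out .north = some .east) : T = .rElbow := by
  cases T <;> simp_all [Tile.out]

/-! ### Tracing pipes -/

section Pipes

variable {n : ℕ} {B : Tiling n n}

/-- At most one pipe enters a given cell in a given direction. -/
theorem Enters.unique {j j' a b : Fin n} {d : Dir} (h : Enters B j a b d)
    (h' : Enters B j' a b d) : j = j' := by
  induction h with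
  | start a ha =>
    cases h' with
    | start _ _ => rfl
    | goNorth a₁ _ _ d₁ _ _ e => have := a₁.isLt; omega
  | goNorth a a' b d hE ho e ih =>
    cases h' with
    | start _ e' => have := a.isLt; omega
    | goNorth a₁ _ _ d₁ hE₁ ho₁ e₁ =>
      obtain rfl : a₁ = a := Fin.ext (by omega)
      obtain rfl := Tile.out_injective ho ho₁
      exact ih hE₁
  | goEast a b b' d hE ho e ih =>
    cases h' with
    | goEast _ b₁ _ d₁ hE₁ ho₁ e₁ =>
      obtain rfl : b₁ = b := Fin.ext (by omega)
      obtain rfl := Tile.out_injective ho ho₁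
      exact ih hE₁

theorem IsPipe.unique {j j' i : Fin n} (h : IsPipe B j i) (h' : IsPipe B j' i) : j = j' := by
  obtain ⟨b, d, hb, hE, ho⟩ := h
  obtain ⟨b', d', hb', hE', ho'⟩ := h'
  obtain rfl : b = b' := Fin.ext (by omega)
  obtain rfl := Tile.out_injective ho ho'
  exact hE.unique hE'

theorem Enters.side (hB : IsBPD B) {j a b : Fin n} {d : Dir} (h : Enters B j a b d) :
    (d = .north → (B a b).south = true) ∧ (d = .east → (B a b).west = true) := by
  cases h with
  | start _ e => exact ⟨fun _ => hB.bottom_border _ _ e, nofun⟩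
  | goNorth a₁ _ _ d₁ _ ho e =>
    exact ⟨fun _ => by rw [hB.match_col _ _ _ e.symm]; exact Tile.north_of_out ho, nofun⟩
  | goEast _ b₁ _ d₁ _ ho e =>
    exact ⟨nofun, fun _ => by rw [← hB.match_row _ _ _ e]; exact Tile.east_of_out ho⟩

/-- Follow the strand backwards. Its previous cell is one row lower or one column to the left, so
the distance to the bottom left corner, `(n - a) + b`, decreases; the left border emits no strand,
so the trace ends at the bottom. -/
theorem exists_enters_aux (hB : IsBPD B) (N : ℕ) : ∀ a b : Fin n, (n - a.val) + b.val = N →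
    ((B a b).south = true → ∃ j, Enters B j a b .north) ∧
      ((B a b).west = true → ∃ j, Enters B j a b .east) := by
  induction N using Nat.strong_induction_on with
  | _ N ih =>
    intro a b hN
    constructor
    · intro h
      by_cases ha : a.val + 1 = n
      · exact ⟨b, .start a ha⟩
      · have hlt : a.val + 1 < n := by have := a.isLt; omega
        let a' : Fin n := ⟨a.val + 1, hlt⟩
        have hnorth : (B a' b).north = true := by rw [← hB.match_col a a' b rfl, h]
        obtain ⟨h1, h2⟩ := ih ((n - a'.val) + b.val)
          (by simp only [a']; omega) a' b rfl
        rcases Tile.out_of_north hnorth with ⟨hs, ho⟩ | ⟨hs, ho⟩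
        · obtain ⟨j, hj⟩ := h1 hs
          exact ⟨j, .goNorth a' a b _ hj ho rfl⟩
        · obtain ⟨j, hj⟩ := h2 hs
          exact ⟨j, .goNorth a' a b _ hj ho rfl⟩
    · intro h
      by_cases hb : b.val = 0
      · rw [hB.left_border a b hb] at h; cases h
      · have hlt : b.val - 1 < n := by have := b.isLt; omega
        let b' : Fin n := ⟨b.val - 1, hlt⟩
        have hb' : b.val = b'.val + 1 := by simp only [b']; omega
        have heast : (B a b').east = true := by rw [hB.match_row a b' b hb', h]
        obtain ⟨h1, h2⟩ := ih ((n - a.val) + b'.val) (by omega) a b' rfl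
        rcases Tile.out_of_east heast with ⟨hs, ho⟩ | ⟨hs, ho⟩
        · obtain ⟨j, hj⟩ := h1 hs
          exact ⟨j, .goEast a b' b _ hj ho hb'⟩
        · obtain ⟨j, hj⟩ := h2 hs
          exact ⟨j, .goEast a b' b _ hj ho hb'⟩

theorem IsBPD.exists_enters (hB : IsBPD B) {a b : Fin n} {d : Dir}
    (hn : d = .north → (B a b).south = true) (he : d = .east → (B a b).west = true) :
    ∃ j, Enters B j a b d := by
  cases d
  · exact (exists_enters_aux hB _ a b rfl).1 (hn rfl)
  · exact (exists_enters_aux hB _ a b rfl).2 (he rfl)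

theorem IsBPD.exists_isPipe (hB : IsBPD B) (i : Fin n) : ∃ j, IsPipe B j i := by
  have hn : 0 < n := i.pos
  let b : Fin n := ⟨n - 1, by omega⟩
  have hb : b.val + 1 = n := by simp only [b]; omega
  rcases Tile.out_of_east (hB.right_border i b hb) with ⟨hs, ho⟩ | ⟨hs, ho⟩
  · obtain ⟨j, hj⟩ := hB.exists_enters (d := .north) (fun _ => hs) nofun
    exact ⟨j, b, _, hb, hj, ho⟩
  · obtain ⟨j, hj⟩ := hB.exists_enters (d := .east) nofun (fun _ => hs)
    exact ⟨j, b, _, hb, hj, ho⟩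

/-! ### Straight runs -/

/-- A vertical strand below which there is no j-elbow comes straight from the bottom. -/
theorem IsBPD.enters_column (hB : IsBPD B) {b : Fin n} (a : Fin n) (hs : (B a b).south = true)
    (hj : ∀ a', a < a' → B a' b ≠ .jElbow) : Enters B b a b .north := by
  obtain ⟨k, hk⟩ : ∃ k, k = n - a.val := ⟨_, rfl⟩
  induction k generalizing a with
  | zero => have := a.isLt; omega
  | succ k ih =>
    by_cases ha : a.val + 1 = n
    · exact .start a ha
    · have hlt : a.val + 1 < n := by have := a.isLt; omega
      let a' : Fin n := ⟨a.val + 1, hlt⟩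
      have haa : a < a' := Fin.lt_def.2 (by simp [a'])
      have h := Tile.south_of_north (by rw [← hB.match_col a a' b rfl, hs]) (hj a' haa)
      exact .goNorth a' a b _ (ih a' h.1 (fun c hc => hj c (haa.trans hc))
        (by simp only [a']; omega)) h.2 rfl

/-- A pipe that moves east in a row without further j-elbows leaves the grid in this row. -/
theorem IsBPD.isPipe_of_row (hB : IsBPD B) {j a : Fin n} {d : Dir} (b : Fin n)
    (hE : Enters B j a b d) (ho : (B a b).out d = some .east)
    (hj : ∀ b', b < b' → B a b' ≠ .jElbow) : IsPipe B j a := by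
  obtain ⟨k, hk⟩ : ∃ k, k = n - b.val := ⟨_, rfl⟩
  induction k generalizing b d with
  | zero => have := b.isLt; omega
  | succ k ih =>
    by_cases hb : b.val + 1 = n
    · exact ⟨b, d, hb, hE, ho⟩
    · have hlt : b.val + 1 < n := by have := b.isLt; omega
      let b' : Fin n := ⟨b.val + 1, hlt⟩
      have hbb : b < b' := Fin.lt_def.2 (by simp [b'])
      have h := Tile.east_of_west
        (by rw [← hB.match_row a b b' rfl, Tile.east_of_out ho]) (hj b' hbb)
      exact ih b' (.goEast a b b' _ hE ho rfl) h.2 (fun c hc => hj c (hbb.trans hc))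
        (by simp only [b']; omega)

/-- A pipe moving north passes through rows without elbows in its column. -/
theorem IsBPD.enters_north (hB : IsBPD B) {j b : Fin n} (a a' : Fin n) (haa : a' ≤ a)
    (hE : Enters B j a b .north)
    (hs : ∀ c, a' < c → c ≤ a → B c b ≠ .rElbow) :
    Enters B j a' b .north := by
  obtain ⟨k, hk⟩ : ∃ k, k = a.val - a'.val := ⟨_, rfl⟩
  rw [Fin.le_def] at haa
  induction k generalizing a with
  | zero => rwa [show a' = a from Fin.ext (by omega)]
  | succ k ih =>
    have ho : (B a b).out .north = some .north := by
      have h1 := hs a (Fin.lt_def.2 (by omega)) le_rfl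
      have h2 := (hE.side hB).1 rfl
      generalize B a b = T at h1 h2
      cases T <;> simp_all [Tile.out, Tile.south]
    let c : Fin n := ⟨a.val - 1, by have := a.isLt; omega⟩
    refine ih c (by simp only [c]; omega) (.goNorth a c b _ hE ho (by simp only [c]; omega))
      (fun e h1 h2 => hs e h1 ?_) (by simp only [c]; omega)
    rw [Fin.le_def] at *
    simp only [c] at h2
    omega

/-- A pipe moving east passes through columns without elbows in its row. -/
theorem IsBPD.enters_east (hB : IsBPD B) {j a : Fin n} {d : Dir} (b b' : Fin n) (hbb : b < b')
    (hE : Enters B j a b d) (ho : (B a b).out d = some .east)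
    (hs : ∀ c, b < c → c < b' → B a c ≠ .jElbow) :
    Enters B j a b' .east := by
  obtain ⟨k, hk⟩ : ∃ k, k = b'.val - b.val := ⟨_, rfl⟩
  rw [Fin.lt_def] at hbb
  induction k generalizing b d with
  | zero => omega
  | succ k ih =>
    let c : Fin n := ⟨b.val + 1, by have := b'.isLt; omega⟩
    have hE' : Enters B j a c .east := .goEast a b c _ hE ho rfl
    by_cases hc : c.val = b'.val
    · rwa [← (Fin.ext hc : c = b')]
    · have hbc : b < c := Fin.lt_def.2 (by simp [c])
      have h1 := hs c hbc (Fin.lt_def.2 (by simp only [c] at *; omega))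
      exact ih c (by simp only [c] at *; omega) hE'
        (Tile.east_of_west ((hE'.side hB).2 rfl) h1).2
        (fun e h2 h3 => hs e (hbc.trans h2) h3) (by simp only [c]; omega)

/-- Scanning from the empty left border, only an r-elbow can start an eastward strand. The next
three lemmas scan from the other borders in the same way. -/
theorem IsBPD.west_eq_false (hB : IsBPD B) {a : Fin n} (b : Fin n)
    (h : ∀ c, c < b → B a c ≠ .rElbow) : (B a b).west = false := by
  obtain ⟨k, hk⟩ : ∃ k, k = b.val := ⟨_, rfl⟩
  induction k generalizing b with
  | zero => exact hB.left_border a b hk.symm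
  | succ k ih =>
    let c : Fin n := ⟨k, by have := b.isLt; omega⟩
    have hcb : c < b := Fin.lt_def.2 (by simp only [c]; omega)
    have h1 := ih c (fun e he => h e (he.trans hcb)) rfl
    have h2 := h c hcb
    rw [← hB.match_row a c b (by simp only [c]; omega)]
    generalize B a c = T at h1 h2
    cases T <;> simp_all [Tile.west, Tile.east]

theorem IsBPD.north_eq_false (hB : IsBPD B) {b : Fin n} (a : Fin n)
    (h : ∀ c, c < a → B c b ≠ .rElbow) : (B a b).north = false := by
  obtain ⟨k, hk⟩ : ∃ k, k = a.val := ⟨_, rfl⟩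
  induction k generalizing a with
  | zero => exact hB.top_border a b hk.symm
  | succ k ih =>
    let c : Fin n := ⟨k, by have := a.isLt; omega⟩
    have hcb : c < a := Fin.lt_def.2 (by simp only [c]; omega)
    have h1 := ih c (fun e he => h e (he.trans hcb)) rfl
    have h2 := h c hcb
    rw [← hB.match_col c a b (by simp only [c]; omega)]
    generalize B c b = T at h1 h2
    cases T <;> simp_all [Tile.north, Tile.south]

theorem IsBPD.east_eq_true (hB : IsBPD B) {a : Fin n} (b : Fin n)
    (h : ∀ c, b < c → B a c ≠ .rElbow) : (B a b).east = true := by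
  obtain ⟨k, hk⟩ : ∃ k, k = n - b.val := ⟨_, rfl⟩
  induction k generalizing b with
  | zero => have := b.isLt; omega
  | succ k ih =>
    by_cases hb : b.val + 1 = n
    · exact hB.right_border a b hb
    let c : Fin n := ⟨b.val + 1, by have := b.isLt; omega⟩
    have hcb : b < c := Fin.lt_def.2 (by simp [c])
    have h1 := ih c (fun e he => h e (hcb.trans he)) (by simp only [c]; omega)
    have h2 := h c hcb
    rw [hB.match_row a b c rfl]
    generalize B a c = T at h1 h2
    cases T <;> simp_all [Tile.west, Tile.east]

theorem IsBPD.south_eq_true (hB : IsBPD B) {b : Fin n} (a : Fin n)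
    (h : ∀ c, a < c → B c b ≠ .rElbow) : (B a b).south = true := by
  obtain ⟨k, hk⟩ : ∃ k, k = n - a.val := ⟨_, rfl⟩
  induction k generalizing a with
  | zero => have := a.isLt; omega
  | succ k ih =>
    by_cases hb : a.val + 1 = n
    · exact hB.bottom_border a b hb
    let c : Fin n := ⟨a.val + 1, by have := a.isLt; omega⟩
    have hcb : a < c := Fin.lt_def.2 (by simp [c])
    have h1 := ih c (fun e he => h e (hcb.trans he)) (by simp only [c]; omega)
    have h2 := h c hcb
    rw [hB.match_col a c b rfl]
    generalize B c b = T at h1 h2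
    cases T <;> simp_all [Tile.north, Tile.south]

theorem IsBPD.east_eq_west (hB : IsBPD B) {a : Fin n} (b b' : Fin n) (hbb : b < b')
    (h : ∀ c, b < c → c < b' → B a c ≠ .rElbow ∧ B a c ≠ .jElbow) :
    (B a b).east = (B a b').west := by
  obtain ⟨k, hk⟩ : ∃ k, k = b'.val - b.val := ⟨_, rfl⟩
  rw [Fin.lt_def] at hbb
  induction k generalizing b with
  | zero => omega
  | succ k ih =>
    let c : Fin n := ⟨b.val + 1, by have := b'.isLt; omega⟩
    rw [hB.match_row a b c rfl]
    by_cases hc : c.val = b'.val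
    · rw [(Fin.ext hc : c = b')]
    · have hbc : b < c := Fin.lt_def.2 (by simp [c])
      obtain ⟨h1, h2⟩ := h c hbc (Fin.lt_def.2 (by simp only [c] at *; omega))
      rw [Tile.west_eq_east h1 h2]
      exact ih c (by simp only [c] at *; omega) (fun e h2 h3 => h e (hbc.trans h2) h3)
        (by simp only [c]; omega)

theorem IsBPD.south_eq_north (hB : IsBPD B) {b : Fin n} (a a' : Fin n) (haa : a < a')
    (h : ∀ c, a < c → c < a' → B c b ≠ .rElbow ∧ B c b ≠ .jElbow) :
    (B a b).south = (B a' b).north := by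
  obtain ⟨k, hk⟩ : ∃ k, k = a'.val - a.val := ⟨_, rfl⟩
  rw [Fin.lt_def] at haa
  induction k generalizing a with
  | zero => omega
  | succ k ih =>
    let c : Fin n := ⟨a.val + 1, by have := a'.isLt; omega⟩
    rw [hB.match_col a c b rfl]
    by_cases hc : c.val = a'.val
    · rw [(Fin.ext hc : c = a')]
    · have hbc : a < c := Fin.lt_def.2 (by simp [c])
      obtain ⟨h1, h2⟩ := h c hbc (Fin.lt_def.2 (by simp only [c] at *; omega))
      rw [Tile.north_eq_south h1 h2]
      exact ih c (by simp only [c] at *; omega) (fun e h2 h3 => h e (hbc.trans h2) h3)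
        (by simp only [c]; omega)

/-- A bumpless pipe dream is determined by its elbows. -/
theorem IsBPD.ext_elbows {B' : Tiling n n} (hB : IsBPD B) (hB' : IsBPD B')
    (hr : ∀ a b, B a b = .rElbow ↔ B' a b = .rElbow)
    (hj : ∀ a b, B a b = .jElbow ↔ B' a b = .jElbow) : B = B' := by
  -- Induction on the antidiagonal: the north and west sides of a tile are dictated by its
  -- neighbours above and to the left.
  suffices H : ∀ N : ℕ, ∀ a b : Fin n, a.val + b.val = N → B a b = B' a b by
    funext a b
    exact H _ a b rfl
  intro N
  induction N using Nat.strong_induction_on with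
  | _ N ih =>
    intro a b hN
    refine Tile.ext_elbow ?_ ?_ (hr a b) (hj a b)
    · by_cases ha : a.val = 0
      · rw [hB.top_border a b ha, hB'.top_border a b ha]
      · let c : Fin n := ⟨a.val - 1, by have := a.isLt; omega⟩
        have hc : a.val = c.val + 1 := by simp only [c]; omega
        rw [← hB.match_col c a b hc, ← hB'.match_col c a b hc,
          ih (c.val + b.val) (by omega) c b rfl]
    · by_cases hb : b.val = 0
      · rw [hB.left_border a b hb, hB'.left_border a b hb]
      · let c : Fin n := ⟨b.val - 1, by have := b.isLt; omega⟩
        have hc : b.val = c.val + 1 := by simp only [c]; omega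
        rw [← hB.match_row a c b hc, ← hB'.match_row a c b hc,
          ih (a.val + c.val) (by omega) a c rfl]

/-! ### The order of the cells along a pipe -/

/-- One step of a pipe, from the entry into a cell to the entry into the next cell. -/
inductive Step (B : Tiling n n) : Fin n × Fin n × Dir → Fin n × Fin n × Dir → Prop
  | north (a a' b : Fin n) (d : Dir) : (B a b).out d = some .north → a'.val + 1 = a.val →
      Step B (a, b, d) (a', b, .north)
  | east (a b b' : Fin n) (d : Dir) : (B a b).out d = some .east → b'.val = b.val + 1 →
      Step B (a, b, d) (a, b', .east)

open Relation in
/-- The cells that a pipe reaches after a given one. -/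
abbrev Reach (B : Tiling n n) : Fin n × Fin n × Dir → Fin n × Fin n × Dir → Prop :=
  ReflTransGen (Step B)

theorem Step.rightUnique : Relator.RightUnique (Step B) := by
  intro p q r h h'
  cases h with
  | north a a' b d ho e =>
    cases h' with
    | north _ a₁ _ _ _ e₁ => rw [show a' = a₁ from Fin.ext (by omega)]
    | east _ _ _ _ ho₁ _ => rw [ho] at ho₁; cases ho₁
  | east a b b' d ho e =>
    cases h' with
    | north _ a₁ _ _ ho₁ e₁ => rw [ho] at ho₁; cases ho₁
    | east _ _ b₁ _ _ e₁ => rw [show b' = b₁ from Fin.ext (by omega)]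

theorem Enters.exists_reach {j a b : Fin n} {d : Dir} (h : Enters B j a b d) :
    ∃ a₀ : Fin n, a₀.val + 1 = n ∧ Reach B (a₀, j, .north) (a, b, d) := by
  induction h with
  | start a ha => exact ⟨a, ha, .refl⟩
  | goNorth a a' b d _ ho e ih =>
    obtain ⟨a₀, h0, h⟩ := ih
    exact ⟨a₀, h0, h.tail (.north _ _ _ _ ho e)⟩
  | goEast a b b' d _ ho e ih =>
    obtain ⟨a₀, h0, h⟩ := ih
    exact ⟨a₀, h0, h.tail (.east _ _ _ _ ho e)⟩

/-- Steps are deterministic, so all entries of one pipe lie on a single trajectory from the bottom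
of its column and are linearly ordered. -/
theorem Enters.reach_or_reach {j a b a' b' : Fin n} {d d' : Dir} (h : Enters B j a b d)
    (h' : Enters B j a' b' d') :
    Reach B (a, b, d) (a', b', d') ∨ Reach B (a', b', d') (a, b, d) := by
  obtain ⟨a₀, h0, hr⟩ := h.exists_reach
  obtain ⟨a₁, h1, hr'⟩ := h'.exists_reach
  obtain rfl : a₀ = a₁ := Fin.ext (by omega)
  exact Relation.ReflTransGen.total_of_right_unique Step.rightUnique hr hr'

theorem Reach.le {p q : Fin n × Fin n × Dir} (h : Reach B p q) :
    q.1 ≤ p.1 ∧ p.2.1 ≤ q.2.1 := by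
  induction h with
  | refl => exact ⟨le_rfl, le_rfl⟩
  | tail _ hs ih =>
    cases hs <;> simp only [Fin.le_def] at ih ⊢ <;> omega

theorem Reach.eq_or_lt_of_east {p : Fin n × Fin n × Dir} {a b : Fin n}
    (h : Reach B p (a, b, .east)) : p = (a, b, .east) ∨ p.2.1 < b := by
  rcases Relation.ReflTransGen.cases_tail h with h | ⟨q, hq, hs⟩
  · exact .inl h.symm
  · right
    have := Reach.le hq
    cases hs
    simp only [Fin.le_def, Fin.lt_def] at this ⊢
    omega

theorem Reach.eq_or_lt_of_north {p : Fin n × Fin n × Dir} {a b : Fin n}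
    (h : Reach B p (a, b, .north)) : p = (a, b, .north) ∨ a < p.1 := by
  rcases Relation.ReflTransGen.cases_tail h with h | ⟨q, hq, hs⟩
  · exact .inl h.symm
  · right
    have := Reach.le hq
    cases hs
    simp only [Fin.le_def, Fin.lt_def] at this ⊢
    omega

/-- An eastward entry into column `b` is preceded only by states in columns strictly to its left, so
a pipe crosses the west boundary of a column at most once. -/
theorem Enters.row_eq {j a a' b : Fin n} (h : Enters B j a b .east)
    (h' : Enters B j a' b .east) : a = a' := by
  rcases h.reach_or_reach h' with h | h <;> rcases h.eq_or_lt_of_east with h | h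
  · exact (Prod.ext_iff.1 h).1
  · exact absurd h (lt_irrefl _)
  · exact (Prod.ext_iff.1 h).1.symm
  · exact absurd h (lt_irrefl _)

theorem Enters.col_eq {j a b b' : Fin n} (h : Enters B j a b .north)
    (h' : Enters B j a b' .north) : b = b' := by
  rcases h.reach_or_reach h' with h | h <;> rcases h.eq_or_lt_of_north with h | h
  · exact (Prod.ext_iff.1 (Prod.ext_iff.1 h).2).1
  · exact absurd h (lt_irrefl _)
  · exact (Prod.ext_iff.1 (Prod.ext_iff.1 h).2).1.symm
  · exact absurd h (lt_irrefl _)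

/-- Between moving east and moving north there is a j-elbow. -/
theorem Reach.exists_jElbow {a b : Fin n} {q : Fin n × Fin n × Dir}
    (h : Reach B (a, b, .east) q) (hq : q.2.2 = .north) :
    ∃ c d, B c d = .jElbow ∧ q.1 < c ∧ b ≤ d := by
  induction h with
  | refl => cases hq
  | tail hr hs ih =>
    cases hs with
    | north c c' e d ho hc =>
      cases d with
      | north =>
        obtain ⟨c₁, d₁, h1, h2, h3⟩ := ih rfl
        refine ⟨c₁, d₁, h1, ?_, h3⟩
        simp only [Fin.lt_def] at h2 ⊢
        omega
      | east =>
        exact ⟨c, e, Tile.eq_jElbow_of_out ho, Fin.lt_def.2 (by simp only; omega), (Reach.le hr).2⟩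
    | east => cases hq

theorem Enters.start_lt {j a b : Fin n} (h : Enters B j a b .east) : j < b := by
  obtain ⟨a₀, _, hr⟩ := h.exists_reach
  rcases hr.eq_or_lt_of_east with h | h
  · simp at h
  · exact h

/-- A pipe leaves in a row weakly above every cell that it enters. -/
theorem IsPipe.le {i j a b : Fin n} {d : Dir} (hp : IsPipe B j i) (h : Enters B j a b d) :
    i ≤ a := by
  obtain ⟨c, e, hc, hE, ho⟩ := hp
  rcases h.reach_or_reach hE with hr | hr
  · exact hr.le.1
  -- Nothing follows the exit state: its strand goes east out of the last column.
  · rcases Relation.ReflTransGen.cases_head hr with hr | ⟨q, hs, _⟩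
    · exact (Prod.ext_iff.1 hr).1.le
    · cases hs with
      | north _ _ _ _ ho' _ => rw [ho] at ho'; cases ho'
      | east _ _ b' _ _ hb => have := b'.isLt; omega

/-- In the region to the south-east of a cell, a j-elbow that is furthest to the south-east
produces two pipes that bend only once and cross. -/
theorem IsBPD.exists_inversion (hB : IsBPD B) {x y c d : Fin n} (hj : B c d = .jElbow)
    (hc : x < c) (hd : y < d) :
    ∃ i i' k k', x < i ∧ i < i' ∧ y < k' ∧ k' < k ∧ IsPipe B k i ∧ IsPipe B k' i' := by
  classical
  let S : Finset (Fin n × Fin n) :=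
    Finset.univ.filter fun p => B p.1 p.2 = .jElbow ∧ x < p.1 ∧ y < p.2
  have hS : S.Nonempty := ⟨(c, d), by simp [S, hj, hc, hd]⟩
  -- Maximizing the sum of the coordinates leaves no other j-elbow weakly south-east of the chosen
  -- one.
  obtain ⟨⟨i, k'⟩, hmem, hmax⟩ := S.exists_max_image (fun p => p.1.val + p.2.val) hS
  obtain ⟨hij, hxi, hyk⟩ : B i k' = .jElbow ∧ x < i ∧ y < k' := by simpa [S] using hmem
  have hfar : ∀ a b, i ≤ a → k' ≤ b → i.val + k'.val < a.val + b.val → B a b ≠ .jElbow := by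
    intro a b ha hb hlt h
    have := hmax (a, b) (by simp [S, h, hxi.trans_le ha, hyk.trans_le hb])
    simp only at this
    omega
  -- The east and south sides of a j-elbow are empty, but row `i` must end, and column `k'` must
  -- start, with a strand. So there are r-elbows further east and further south; their pipes have no
  -- j-elbow to bend at and are hooks.
  obtain ⟨k, hk, hik⟩ : ∃ k, k' < k ∧ B i k = .rElbow := by
    by_contra! h
    have := hB.east_eq_true k' h
    simp [hij, Tile.east] at this
  obtain ⟨i', hi, hik'⟩ : ∃ i', i < i' ∧ B i' k' = .rElbow := by
    by_contra! h
    have := hB.south_eq_true i h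
    simp [hij, Tile.south] at this
  refine ⟨i, i', k, k', hxi, hi, hyk, hk, ?_, ?_⟩
  · refine hB.isPipe_of_row k (d := .north) (hB.enters_column i (by simp [hik, Tile.south])
      fun a ha => hfar a k ha.le hk.le ?_) (by simp [hik, Tile.out])
      fun b hb => hfar i b le_rfl (hk.trans hb).le ?_
    all_goals rw [Fin.lt_def] at *; omega
  · refine hB.isPipe_of_row k' (d := .north) (hB.enters_column i' (by simp [hik', Tile.south])
      fun a ha => hfar a k' (hi.trans ha).le le_rfl ?_) (by simp [hik', Tile.out])
      fun b hb => hfar i' b hi.le hb.le ?_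
    all_goals rw [Fin.lt_def] at *; omega

theorem CrossAt.symm {j j' a b : Fin n} (h : CrossAt B j j' a b) : CrossAt B j' j a b :=
  ⟨h.1, h.2.symm.imp And.symm And.symm⟩

theorem IsReduced.cell_unique (h : IsReduced B) {j j' a b a' b' : Fin n} (hne : j ≠ j')
    (h1 : CrossAt B j j' a b) (h2 : CrossAt B j j' a' b') : a = a' ∧ b = b' := by
  have := @h j j' hne (a, b) h1 (a', b') h2
  rwa [Prod.mk.injEq] at this

end Pipes

/-! ### Pattern avoidance -/

theorem Avoids.not_lt {n : ℕ} {w : Equiv.Perm (Fin n)} (hw : Avoids w perm1243)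
    {a b c d : Fin n} (hab : a < b) (hbc : b < c) (hcd : c < d) (h1 : w a < w b)
    (h2 : w b < w d) (h3 : w d < w c) : False := by
  have hmono : StrictMono ![a, b, c, d] := by
    rw [Fin.strictMono_iff_lt_succ]
    intro i
    fin_cases i <;> simp [hab, hbc, hcd]
  apply hw (OrderEmbedding.ofStrictMono _ hmono)
  -- Swapping the last two letters sorts the word, so this swap is its sorting permutation; being an
  -- involution, it is also the standardization.
  have hsm : StrictMono
      (subword w (OrderEmbedding.ofStrictMono _ hmono) ∘ (Equiv.swap 2 3 : Equiv.Perm (Fin 4))) := by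
    rw [Fin.strictMono_iff_lt_succ]
    intro i
    fin_cases i
    · simpa [subword, Equiv.swap_apply_def] using h1
    · simpa [subword, Equiv.swap_apply_def] using h2
    · simpa [subword, Equiv.swap_apply_def] using h3
  have : (Equiv.swap 2 3 : Equiv.Perm (Fin 4)) = Tuple.sort _ :=
    Tuple.eq_sort_iff.2 ⟨hsm.monotone, fun i j hij h => absurd h (hsm hij).ne⟩
  rw [perm, ← this, perm1243, Equiv.swap_inv]

/-! ### Hooks -/

section Hooks

variable {n m : ℕ} {w : Equiv.Perm (Fin n)} {s : Fin m ↪o Fin n} {B : Tiling n n}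

theorem sortedEntries_ne {x : Fin n} (hx : x ∉ Set.range s) (k : Fin m) :
    sortedEntries (subword w s) k ≠ w x := by
  intro h
  apply hx
  refine ⟨Tuple.sort (subword w s) k, w.injective h⟩

theorem exists_of_notMem_range {y : Fin n} (hy : y ∉ Set.range (sortedEntries (subword w s))) :
    ∃ x, x ∉ Set.range s ∧ y = w x := by
  refine ⟨w.symm y, ?_, by simp⟩
  rintro ⟨i, hi⟩
  exact hy ⟨perm (subword w s) i, by rw [sortedEntries_perm, subword, hi]; simp⟩

/-- For `x` not a position of the subword, row `x` and column `w x` have exactly one elbow, an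
r-elbow in their common cell. -/
structure Hooked (w : Equiv.Perm (Fin n)) (s : Fin m ↪o Fin n) (B : Tiling n n) : Prop where
  corner : ∀ x ∉ Set.range s, B x (w x) = .rElbow
  row : ∀ x ∉ Set.range s, ∀ b, b ≠ w x → B x b ≠ .rElbow ∧ B x b ≠ .jElbow
  col : ∀ x ∉ Set.range s, ∀ a, a ≠ x → B a (w x) ≠ .rElbow ∧ B a (w x) ≠ .jElbow

/-- The pipe of a hook stays on the hook. -/
theorem Hooked.enters (hH : Hooked w s B) {x : Fin n} (hx : x ∉ Set.range s) {a b : Fin n}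
    {d : Dir} (h : Enters B (w x) a b d) :
    (b = w x ∧ d = .north ∧ x ≤ a) ∨ (a = x ∧ d = .east ∧ w x < b) := by
  induction h with
  | start a ha => exact .inl ⟨rfl, rfl, Fin.le_def.2 (by have := x.isLt; omega)⟩
  | goNorth a a' b d _ ho e ih =>
    rcases ih with ⟨rfl, rfl, hxa⟩ | ⟨rfl, rfl, hb⟩
    · refine .inl ⟨rfl, rfl, ?_⟩
      have : x ≠ a := by
        rintro rfl
        simp [hH.corner x hx, Tile.out] at ho
      rw [Fin.le_def] at *
      rw [Ne, Fin.ext_iff] at this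
      omega
    · exact absurd (Tile.eq_jElbow_of_out ho) (hH.row _ hx b hb.ne').2
  | goEast a b b' d _ ho e ih =>
    rcases ih with ⟨rfl, rfl, hxa⟩ | ⟨rfl, rfl, hb⟩
    · have : a = x := by
        by_contra hne
        exact (hH.col x hx a hne).1 (Tile.eq_rElbow_of_out ho)
      exact .inr ⟨this, rfl, Fin.lt_def.2 (by omega)⟩
    · exact .inr ⟨rfl, rfl, Fin.lt_def.2 (by rw [Fin.lt_def] at hb; omega)⟩

theorem Hooked.enters_corner (hH : Hooked w s B) (hB : IsBPD B) {x : Fin n}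
    (hx : x ∉ Set.range s) : Enters B (w x) x (w x) .north :=
  hB.enters_column x (by simp [hH.corner x hx, Tile.south]) fun a ha => (hH.col x hx a ha.ne').2

theorem Hooked.isPipe (hH : Hooked w s B) (hB : IsBPD B) {x : Fin n}
    (hx : x ∉ Set.range s) : IsPipe B (w x) x :=
  hB.isPipe_of_row (w x) (hH.enters_corner hB hx) (by simp [hH.corner x hx, Tile.out])
    fun b hb => (hH.row x hx b hb.ne').2

/-- A strand that enters a cell of row `x` from the west belongs to the hook. -/
theorem Hooked.eq_of_enters_east (hH : Hooked w s B) (hB : IsBPD B) {x : Fin n}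
    (hx : x ∉ Set.range s) {j b : Fin n} (h : Enters B j x b .east) : j = w x := by
  have hb : w x < b := by
    by_contra hle
    have := hB.west_eq_false (a := x) b
      fun c hc => (hH.row x hx c (hc.trans_le (not_lt.1 hle)).ne).1
    rw [(h.side hB).2 rfl] at this
    cases this
  exact h.unique (hB.enters_east (w x) b hb (hH.enters_corner hB hx)
    (by simp [hH.corner x hx, Tile.out]) fun c h1 _ => (hH.row x hx c h1.ne').2)

/-- A strand that enters a cell of column `w x` from the south belongs to the hook. -/
theorem Hooked.eq_of_enters_north (hH : Hooked w s B) (hB : IsBPD B) {x : Fin n}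
    (hx : x ∉ Set.range s) {j a : Fin n} (h : Enters B j a (w x) .north) : j = w x := by
  refine h.unique (hB.enters_column a ((h.side hB).1 rfl) fun c _ hj => ?_)
  by_cases hc : c = x
  · rw [hc, hH.corner x hx] at hj
    cases hj
  · exact (hH.col x hx c hc).2 hj

/-- The erased pipes stay on their hooks, which meet no cell in a kept row and a kept column, so
erasing changes nothing there. -/
theorem Hooked.phi_apply (hH : Hooked w s B) (a b : Fin m) :
    phi w s B a b = B (s a) (sortedEntries (subword w s) b) := by
  have h : ∀ d, ¬ ∃ j ∈ {y | ∃ x, x ∉ Set.range s ∧ y = w x},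
      Enters B j (s a) (sortedEntries (subword w s) b) d := by
    rintro d ⟨j, ⟨x, hx, rfl⟩, hE⟩
    rcases hH.enters hx hE with ⟨h, _⟩ | ⟨h, _⟩
    · exact sortedEntries_ne hx b h
    · exact hx ⟨a, h⟩
  simp only [phi, contractCols, contractRows, erasePipes, Tile.erase, h, if_false]
  cases B (s a) (sortedEntries (subword w s) b) <;> rfl

/-- Removability speaks of r-elbows only, but also excludes j-elbows. In the row, a j-elbow needs a
strand from an r-elbow further west, and its empty east side forces an r-elbow further east; on one
of the two sides there is none. The column is analogous. -/
theorem Hooked.of_mem_BPDsub (h : B ∈ BPDsub w s) : Hooked w s B := by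
  have hB : IsBPD B := h.1.1
  have hrem : ∀ x ∉ Set.range s, IsRemovable B (w x) x := fun x hx => (h.2 _ _).2 ⟨rfl, hx⟩
  refine ⟨fun x hx => (hrem x hx).2.1, fun x hx b hb => ?_, fun x hx a ha => ?_⟩
  · obtain ⟨-, hc, hr, -⟩ := hrem x hx
    refine ⟨fun h => hb (hr b h), fun hj => ?_⟩
    rcases lt_or_gt_of_ne hb with hlt | hlt
    · have := hB.west_eq_false (a := x) b fun c hc h => (hc.trans hlt).ne (hr c h)
      simp [hj, Tile.west] at this
    · have := hB.east_eq_true (a := x) b fun c hc h => (hlt.trans hc).ne' (hr c h)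
      simp [hj, Tile.east] at this
  · obtain ⟨-, hc, -, hr⟩ := hrem x hx
    refine ⟨fun h => ha (hr a h), fun hj => ?_⟩
    rcases lt_or_gt_of_ne ha with hlt | hlt
    · have := hB.north_eq_false (b := w x) a fun c hc h => (hc.trans hlt).ne (hr c h)
      simp [hj, Tile.north] at this
    · have := hB.south_eq_true (b := w x) a fun c hc h => (hlt.trans hc).ne' (hr c h)
      simp [hj, Tile.south] at this

theorem StrictMono.notMem_range_of_between {f : Fin m → Fin n} (hf : StrictMono f) {a b : Fin m}
    (hab : b.val = a.val + 1) {c : Fin n} (h1 : f a < c) (h2 : c < f b) : c ∉ Set.range f := by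
  rintro ⟨k, rfl⟩
  rw [hf.lt_iff_lt, Fin.lt_def] at h1 h2
  omega

theorem StrictMono.notMem_range_of_lt_zero {f : Fin m → Fin n} (hf : StrictMono f) {a : Fin m}
    (ha : a.val = 0) {c : Fin n} (h : c < f a) : c ∉ Set.range f := by
  rintro ⟨k, rfl⟩
  rw [hf.lt_iff_lt, Fin.lt_def] at h
  omega

theorem StrictMono.notMem_range_of_last_lt {f : Fin m → Fin n} (hf : StrictMono f) {a : Fin m}
    (ha : a.val + 1 = m) {c : Fin n} (h : f a < c) : c ∉ Set.range f := by
  rintro ⟨k, rfl⟩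
  rw [hf.lt_iff_lt, Fin.lt_def] at h
  omega

theorem Hooked.straight_row (hH : Hooked w s B) {c : Fin n} (hc : c ∉ Set.range s) (b : Fin m) :
    B c (sortedEntries (subword w s) b) ≠ .rElbow ∧
      B c (sortedEntries (subword w s) b) ≠ .jElbow :=
  hH.row c hc _ (sortedEntries_ne hc b)

theorem Hooked.straight_col (hH : Hooked w s B) {c : Fin n}
    (hc : c ∉ Set.range (sortedEntries (subword w s))) (a : Fin m) :
    B (s a) c ≠ .rElbow ∧ B (s a) c ≠ .jElbow := by
  obtain ⟨x, hx, rfl⟩ := exists_of_notMem_range hc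
  exact hH.col x hx _ fun h => hx ⟨a, h⟩

/-! ### Comparing a tiling `B` that contains the hooks with its submatrix `C`. -/

variable {C : Tiling m m}

theorem Hooked.isBPD (hH : Hooked w s B) (hB : IsBPD B)
    (hC : ∀ a b, C a b = B (s a) (sortedEntries (subword w s) b)) : IsBPD C := by
  have hs := s.strictMono
  have ht := sortedEntries_strictMono w s
  constructor
  · intro a b b' h
    rw [hC, hC]
    exact hB.east_eq_west _ _ (ht (Fin.lt_def.2 (by omega))) fun c h1 h2 =>
      hH.straight_col (StrictMono.notMem_range_of_between ht h h1 h2) a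
  · intro a a' b h
    rw [hC, hC]
    exact hB.south_eq_north _ _ (hs (Fin.lt_def.2 (by omega))) fun c h1 h2 =>
      hH.straight_row (StrictMono.notMem_range_of_between hs h h1 h2) b
  · intro a b h
    rw [hC]
    exact hB.west_eq_false _ fun c hc =>
      (hH.straight_col (StrictMono.notMem_range_of_lt_zero ht h hc) a).1
  · intro a b h
    rw [hC]
    exact hB.north_eq_false _ fun c hc =>
      (hH.straight_row (StrictMono.notMem_range_of_lt_zero hs h hc) b).1
  · intro a b h
    rw [hC]
    exact hB.east_eq_true _ fun c hc =>
      (hH.straight_col (StrictMono.notMem_range_of_last_lt ht h hc) a).1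
  · intro a b h
    rw [hC]
    exact hB.south_eq_true _ fun c hc =>
      (hH.straight_row (StrictMono.notMem_range_of_last_lt hs h hc) b).1

theorem Hooked.enters_of_enters (hH : Hooked w s B) (hB : IsBPD B)
    (hC : ∀ a b, C a b = B (s a) (sortedEntries (subword w s) b)) {j a b : Fin m} {d : Dir}
    (h : Enters C j a b d) :
    Enters B (sortedEntries (subword w s) j) (s a) (sortedEntries (subword w s) b) d := by
  have hs := s.strictMono
  have ht := sortedEntries_strictMono w s
  induction h with
  | start a ha =>
    refine hB.enters_column _ ?_ fun c hc => ?_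
    · exact hB.south_eq_true _ fun c hc =>
        (hH.straight_row (StrictMono.notMem_range_of_last_lt hs ha hc) j).1
    · exact (hH.straight_row (StrictMono.notMem_range_of_last_lt hs ha hc) j).2
  | goNorth a a' b d _ ho e ih =>
    rw [hC] at ho
    have hlt : s a' < s a := hs (Fin.lt_def.2 (by omega))
    rw [Fin.lt_def] at hlt
    -- The turn in row `s a` depends on `d` and is taken as a single step; from row `c` on, the pipe
    -- runs straight north through the deleted rows.
    let c : Fin n := ⟨(s a).val - 1, by have := (s a).isLt; omega⟩
    refine hB.enters_north c _ (Fin.le_def.2 (by simp only [c]; omega))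
      (.goNorth _ c _ _ ih ho (by simp only [c]; omega)) fun e' h1 h2 => ?_
    have h2' : e' < s a := by
      rw [Fin.le_def] at h2
      rw [Fin.lt_def]
      simp only [c] at h2
      omega
    exact (hH.straight_row (StrictMono.notMem_range_of_between hs e.symm h1 h2') b).1
  | goEast a b b' d _ ho e ih =>
    rw [hC] at ho
    exact hB.enters_east _ _ (ht (Fin.lt_def.2 (by omega))) ih ho fun c h1 h2 =>
      (hH.straight_col (StrictMono.notMem_range_of_between ht e h1 h2) a).2

/-- For the converse, the strand of `C` at this cell belongs to some pipe; its image enters the same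
cell of `B` in the same direction, so uniqueness identifies the two pipes. -/
theorem Hooked.enters_iff (hH : Hooked w s B) (hB : IsBPD B)
    (hC : ∀ a b, C a b = B (s a) (sortedEntries (subword w s) b)) {j a b : Fin m} {d : Dir} :
    Enters C j a b d ↔
      Enters B (sortedEntries (subword w s) j) (s a) (sortedEntries (subword w s) b) d := by
  refine ⟨hH.enters_of_enters hB hC, fun h => ?_⟩
  have hside := h.side hB
  rw [← hC] at hside
  obtain ⟨j', hj'⟩ := (hH.isBPD hB hC).exists_enters hside.1 hside.2
  rwa [(sortedEntries_strictMono w s).injective (h.unique (hH.enters_of_enters hB hC hj'))]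

theorem Hooked.isPipe_of_isPipe (hH : Hooked w s B) (hB : IsBPD B)
    (hC : ∀ a b, C a b = B (s a) (sortedEntries (subword w s) b)) {j a : Fin m}
    (h : IsPipe C j a) : IsPipe B (sortedEntries (subword w s) j) (s a) := by
  obtain ⟨b, d, hb, hE, ho⟩ := h
  rw [hC] at ho
  exact hB.isPipe_of_row _ (hH.enters_of_enters hB hC hE) ho fun c hc =>
    (hH.straight_col (StrictMono.notMem_range_of_last_lt (sortedEntries_strictMono w s) hb hc) a).2

theorem Hooked.isPipe_iff (hH : Hooked w s B) (hB : IsBPD B)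
    (hC : ∀ a b, C a b = B (s a) (sortedEntries (subword w s) b)) {j a : Fin m} :
    IsPipe C j a ↔ IsPipe B (sortedEntries (subword w s) j) (s a) := by
  refine ⟨hH.isPipe_of_isPipe hB hC, fun h => ?_⟩
  obtain ⟨j', hj'⟩ := (hH.isBPD hB hC).exists_isPipe a
  rwa [(sortedEntries_strictMono w s).injective (h.unique (hH.isPipe_of_isPipe hB hC hj'))]

theorem Hooked.mem_BPD_iff (hH : Hooked w s B) (hB : IsBPD B)
    (hC : ∀ a b, C a b = B (s a) (sortedEntries (subword w s) b)) :
    C ∈ BPD (perm (subword w s)) ↔ B ∈ BPD w := by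
  have key : ∀ i, IsPipe C (perm (subword w s) i) i ↔ IsPipe B (w (s i)) (s i) := fun i => by
    rw [hH.isPipe_iff hB hC, sortedEntries_perm, subword]
  constructor
  · rintro ⟨-, h⟩
    refine ⟨hB, fun i => ?_⟩
    by_cases hi : i ∈ Set.range s
    · obtain ⟨k, rfl⟩ := hi
      exact (key k).1 (h k)
    · exact hH.isPipe hB hi
  · rintro ⟨-, h⟩
    exact ⟨hH.isBPD hB hC, fun i => (key i).2 (h _)⟩

/-- A deleted row or column has its only elbow at the corner of its hook, which lies in no kept row
or column. So the uniqueness conditions on r-elbows are unaffected. -/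
theorem Hooked.isRemovable_iff (hH : Hooked w s B) (hB : IsBPD B)
    (hC : ∀ a b, C a b = B (s a) (sortedEntries (subword w s) b)) {j a : Fin m} :
    IsRemovable C j a ↔ IsRemovable B (sortedEntries (subword w s) j) (s a) := by
  have ht := (sortedEntries_strictMono w s).injective
  simp only [IsRemovable, hH.isPipe_iff hB hC, hC]
  refine and_congr_right fun _ => and_congr_right fun _ => and_congr ?_ ?_
  · constructor
    · intro h b hb
      by_cases hbt : b ∈ Set.range (sortedEntries (subword w s))
      · obtain ⟨k, rfl⟩ := hbt
        rw [h k hb]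
      · exact absurd hb (hH.straight_col hbt a).1
    · exact fun h b hb => ht (h _ hb)
  · constructor
    · intro h b hb
      by_cases hbt : b ∈ Set.range s
      · obtain ⟨k, rfl⟩ := hbt
        rw [h k hb]
      · exact absurd hb (hH.straight_row hbt j).1
    · exact fun h b hb => s.injective (h _ hb)

/-- The hooks are removable in any case, so the only question is whether a kept pipe is removable as
well. -/
theorem Hooked.isMinimal_iff (hH : Hooked w s B) (hB : B ∈ BPD w)
    (hC : ∀ a b, C a b = B (s a) (sortedEntries (subword w s) b)) :
    IsMinimal C ↔ B ∈ BPDsub w s := by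
  constructor
  · intro hmin
    refine ⟨hB, fun j i => ⟨fun h => ?_, ?_⟩⟩
    · obtain rfl : j = w i := h.1.unique (hB.2 i)
      refine ⟨rfl, ?_⟩
      rintro ⟨k, rfl⟩
      refine hmin (perm (subword w s) k) k ((hH.isRemovable_iff hB.1 hC).2 ?_)
      rwa [sortedEntries_perm]
    · rintro ⟨rfl, hi⟩
      refine ⟨hB.2 i, hH.corner i hi, fun b hb => ?_, fun a ha => ?_⟩
      · by_contra hne
        exact (hH.row i hi b hne).1 hb
      · by_contra hne
        exact (hH.col i hi a hne).1 ha
  · intro h j i hr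
    exact ((h.2 _ _).1 ((hH.isRemovable_iff hB.1 hC).1 hr)).2 ⟨i, rfl⟩

/-! ### Crossings and reducedness. -/

theorem Hooked.crossAt_iff (hH : Hooked w s B) (hB : IsBPD B)
    (hC : ∀ a b, C a b = B (s a) (sortedEntries (subword w s) b)) {j j' a b : Fin m} :
    CrossAt C j j' a b ↔ CrossAt B (sortedEntries (subword w s) j)
      (sortedEntries (subword w s) j') (s a) (sortedEntries (subword w s) b) := by
  simp only [CrossAt, hH.enters_iff hB hC, hC]

theorem Hooked.isReduced_of_isReduced (hH : Hooked w s B) (hB : IsBPD B)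
    (hC : ∀ a b, C a b = B (s a) (sortedEntries (subword w s) b)) (h : IsReduced B) :
    IsReduced C := by
  have ht := (sortedEntries_strictMono w s).injective
  rintro j j' hne ⟨a, b⟩ h1 ⟨a', b'⟩ h2
  have := h.cell_unique (ht.ne hne) ((hH.crossAt_iff hB hC).1 h1) ((hH.crossAt_iff hB hC).1 h2)
  exact Prod.ext (s.injective this.1) (ht this.2)

/-- The cells where a hook is crossed by another pipe. -/
theorem Hooked.crossAt (hH : Hooked w s B) {x : Fin n} (hx : x ∉ Set.range s) {j a b : Fin n}
    (h : CrossAt B (w x) j a b) :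
    (b = w x ∧ x < a ∧ Enters B j a b .east) ∨ (a = x ∧ w x < b ∧ Enters B j a b .north) := by
  obtain ⟨hc, ⟨h1, h2⟩ | ⟨h1, h2⟩⟩ := h
  · rcases hH.enters hx h1 with ⟨rfl, -, h⟩ | ⟨-, h, -⟩
    · refine .inl ⟨rfl, lt_of_le_of_ne h ?_, h2⟩
      rintro rfl
      rw [hH.corner x hx] at hc
      cases hc
    · cases h
  · rcases hH.enters hx h1 with ⟨-, h, -⟩ | ⟨rfl, -, h⟩
    · cases h
    · exact .inr ⟨rfl, h, h2⟩

/-- If `w` avoids `1243`, no pipe crosses both legs of a hook. -/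
theorem Hooked.not_cross_twice (hH : Hooked w s B) (hB : B ∈ BPD w) (hw : Avoids w perm1243)
    {x : Fin n} (hx : x ∉ Set.range s) {j a b : Fin n} (hne : w x ≠ j) (ha : x < a)
    (h1 : Enters B j a (w x) .east) (h2 : Enters B j x b .north) : False := by
  -- The vertical leg lies below row `x`, so it is crossed first; afterwards the pipe must turn from
  -- east to north.
  have hr : Reach B (a, w x, .east) (x, b, .north) := by
    rcases h1.reach_or_reach h2 with h | h
    · exact h
    · exact absurd h.le.1 (not_le.2 ha)
  obtain ⟨c, d, hcd, hc, hd⟩ := hr.exists_jElbow rfl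
  -- Column `w x` contains no j-elbow, so the turn lies strictly inside the south-east quadrant of
  -- the corner.
  have hd' : w x < d := by
    refine lt_of_le_of_ne hd ?_
    rintro rfl
    exact (hH.col x hx c hc.ne').2 hcd
  obtain ⟨i, i', k, k', hi, hii, hk, hkk, hp, hp'⟩ := hB.1.exists_inversion hcd hc hd'
  obtain rfl := hp.unique (hB.2 i)
  obtain rfl := hp'.unique (hB.2 i')
  obtain ⟨p, rfl⟩ := w.surjective j
  -- The pipe leaves weakly above row `x`, and not in row `x`, where the hook leaves.
  have hpx : p < x := lt_of_le_of_ne ((hB.2 p).le h2) (by rintro rfl; exact hne rfl)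
  exact hw.not_lt hpx hi hii h1.start_lt hk hkk

theorem Hooked.subsingleton_crossAt (hH : Hooked w s B) (hB : B ∈ BPD w)
    (hw : Avoids w perm1243) {x : Fin n} (hx : x ∉ Set.range s) {j : Fin n} (hne : w x ≠ j) :
    {c : Fin n × Fin n | CrossAt B (w x) j c.1 c.2}.Subsingleton := by
  rintro ⟨a, b⟩ h1 ⟨a', b'⟩ h2
  rcases hH.crossAt hx h1 with ⟨h, ha, hE⟩ | ⟨h, ha, hE⟩ <;>
    rcases hH.crossAt hx h2 with ⟨h', ha', hE'⟩ | ⟨h', ha', hE'⟩ <;>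
    simp only at h h' ha ha' hE hE' <;> subst h h'
  · rw [hE.row_eq hE']
  · exact (hH.not_cross_twice hB hw hx hne ha hE hE').elim
  · exact (hH.not_cross_twice hB hw hx hne ha' hE' hE).elim
  · rw [hE.col_eq hE']

/-- A crossing uses both strands of its cell, while in a deleted row the eastward strand, and in a
deleted column the northward one, belongs to a hook. -/
theorem Hooked.mem_range_of_crossAt (hH : Hooked w s B) (hB : IsBPD B) {j j' : Fin m}
    {a b : Fin n} (h : CrossAt B (sortedEntries (subword w s) j)
      (sortedEntries (subword w s) j') a b) :
    a ∈ Set.range s ∧ b ∈ Set.range (sortedEntries (subword w s)) := by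
  constructor
  · by_contra ha
    rcases h.2 with ⟨-, h⟩ | ⟨h, -⟩ <;>
      exact sortedEntries_ne ha _ (hH.eq_of_enters_east hB ha h)
  · by_contra hb
    obtain ⟨x, hx, rfl⟩ := exists_of_notMem_range hb
    rcases h.2 with ⟨h, -⟩ | ⟨-, h⟩ <;>
      exact sortedEntries_ne hx _ (hH.eq_of_enters_north hB hx h)

/-- Two kept pipes cross only in kept cells, where `C` controls them; a pair that includes a hook is
controlled by pattern avoidance. -/
theorem Hooked.isReduced (hH : Hooked w s B) (hB : B ∈ BPD w) (hw : Avoids w perm1243)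
    (hC : ∀ a b, C a b = B (s a) (sortedEntries (subword w s) b)) (h : IsReduced C) :
    IsReduced B := by
  intro j j' hne
  by_cases hj : j ∈ Set.range (sortedEntries (subword w s))
  · by_cases hj' : j' ∈ Set.range (sortedEntries (subword w s))
    · obtain ⟨k, rfl⟩ := hj
      obtain ⟨k', rfl⟩ := hj'
      rintro ⟨a, b⟩ h1 ⟨a', b'⟩ h2
      simp only [Set.mem_ofPred_eq] at h1 h2
      obtain ⟨⟨a, rfl⟩, ⟨b, rfl⟩⟩ := hH.mem_range_of_crossAt hB.1 h1
      obtain ⟨⟨a', rfl⟩, ⟨b', rfl⟩⟩ := hH.mem_range_of_crossAt hB.1 h2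
      rw [← hH.crossAt_iff hB.1 hC] at h1 h2
      have := h.cell_unique (fun e => hne (by rw [e])) h1 h2
      rw [this.1, this.2]
    · obtain ⟨x, hx, rfl⟩ := exists_of_notMem_range hj'
      exact (hH.subsingleton_crossAt hB hw hx hne.symm).anti fun c hc => CrossAt.symm hc
  · obtain ⟨x, hx, rfl⟩ := exists_of_notMem_range hj
    exact hH.subsingleton_crossAt hB hw hx hne

/-- Outside the submatrix the only elbows are the corners of the hooks, at prescribed cells, and the
elbows determine the tiling. -/
theorem Hooked.eq_of_submatrix_eq {B' : Tiling n n} (hH : Hooked w s B) (hH' : Hooked w s B')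
    (hB : IsBPD B) (hB' : IsBPD B')
    (h : ∀ a b, B (s a) (sortedEntries (subword w s) b) =
      B' (s a) (sortedEntries (subword w s) b)) : B = B' := by
  have key : ∀ a b, B a b = B' a b ∨
      ((B a b ≠ .rElbow ∧ B a b ≠ .jElbow) ∧ (B' a b ≠ .rElbow ∧ B' a b ≠ .jElbow)) := by
    intro a b
    by_cases ha : a ∈ Set.range s
    · obtain ⟨a, rfl⟩ := ha
      by_cases hb : b ∈ Set.range (sortedEntries (subword w s))
      · obtain ⟨b, rfl⟩ := hb
        exact .inl (h a b)
      · exact .inr ⟨hH.straight_col hb a, hH'.straight_col hb a⟩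
    · by_cases hb : b = w a
      · rw [hb, hH.corner a ha, hH'.corner a ha]
        exact .inl rfl
      · exact .inr ⟨hH.row a ha b hb, hH'.row a ha b hb⟩
  refine hB.ext_elbows hB' (fun a b => ?_) (fun a b => ?_) <;>
    rcases key a b with h | ⟨⟨h1, h2⟩, h3, h4⟩
  · rw [h]
  · exact iff_of_false h1 h3
  · rw [h]
  · exact iff_of_false h2 h4

end Hooks

/-! ### Inserting hooks -/

section Insertion

variable {n m : ℕ}

/-- The state of column `j` above row `k`: is there a strand on the `k`-th horizontal edge? -/
def colEdge (C : Tiling m m) : ℕ → Fin m → Bool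
  | 0, _ => false
  | k + 1, j => if h : k < m then (C ⟨k, h⟩ j).south else false

/-- The state of row `i` to the left of column `k`: is there a strand on the `k`-th vertical
edge? -/
def rowEdge (C : Tiling m m) (i : Fin m) : ℕ → Bool
  | 0 => false
  | k + 1 => if h : k < m then (C i ⟨k, h⟩).east else false

theorem IsBPD.edges {C : Tiling m m} (hC : IsBPD C) (i j : Fin m) :
    (C i j).north = colEdge C i j ∧ (C i j).south = colEdge C (i + 1) j ∧
      (C i j).west = rowEdge C i j ∧ (C i j).east = rowEdge C i (j + 1) := by
  refine ⟨?_, by simp [colEdge], ?_, by simp [rowEdge]⟩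
  · obtain ⟨i, hi⟩ := i
    cases i with
    | zero => exact hC.top_border _ _ rfl
    | succ k =>
      have hk : k < m := by omega
      simp only [colEdge, hk, dif_pos]
      exact (hC.match_col ⟨k, hk⟩ ⟨k + 1, hi⟩ j rfl).symm
  · obtain ⟨j, hj⟩ := j
    cases j with
    | zero => exact hC.left_border _ _ rfl
    | succ k =>
      have hk : k < m := by omega
      simp only [rowEdge, hk, dif_pos]
      exact (hC.match_row i ⟨k, hk⟩ ⟨k + 1, hj⟩ rfl).symm

theorem IsBPD.edges_last {C : Tiling m m} (hC : IsBPD C) (i : Fin m) :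
    colEdge C m i = true ∧ rowEdge C i m = true := by
  cases m with
  | zero => exact i.elim0
  | succ k =>
    simp only [colEdge, rowEdge, Nat.lt_succ_self, dif_pos]
    exact ⟨hC.bottom_border _ _ rfl, hC.right_border _ _ rfl⟩

/-- A compatible choice of strands on the edges of the grid comes from a bumpless pipe dream. -/
theorem exists_isBPD_of_edges (V : ℕ → Fin n → Bool) (H : Fin n → ℕ → Bool)
    (hV0 : ∀ b, V 0 b = false) (hVn : ∀ b, V n b = true) (hH0 : ∀ a, H a 0 = false)
    (hHn : ∀ a, H a n = true)
    (hT : ∀ a b : Fin n, ∃ T : Tile, T.north = V a b ∧ T.south = V (a + 1) b ∧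
      T.west = H a b ∧ T.east = H a (b + 1)) :
    ∃ B : Tiling n n, IsBPD B ∧ ∀ a b : Fin n, (B a b).north = V a b ∧
      (B a b).south = V (a + 1) b ∧ (B a b).west = H a b ∧ (B a b).east = H a (b + 1) := by
  choose B hB using hT
  refine ⟨B, ⟨fun a b b' h => ?_, fun a a' b h => ?_, fun a b h => ?_, fun a b h => ?_,
    fun a b h => ?_, fun a b h => ?_⟩, hB⟩
  · rw [(hB a b).2.2.2, (hB a b').2.2.1, h]
  · rw [(hB a b).2.1, (hB a' b).1, h]
  · rw [(hB a b).2.2.1, h, hH0]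
  · rw [(hB a b).1, h, hV0]
  · rw [(hB a b).2.2.2, h, hHn]
  · rw [(hB a b).2.1, h, hVn]

theorem Tile.exists_straight (v h : Bool) :
    ∃ T : Tile, T.north = v ∧ T.south = v ∧ T.west = h ∧ T.east = h := by
  cases v <;> cases h
  · exact ⟨.blank, rfl, rfl, rfl, rfl⟩
  · exact ⟨.horizontal, rfl, rfl, rfl, rfl⟩
  · exact ⟨.vertical, rfl, rfl, rfl, rfl⟩
  · exact ⟨.cross, rfl, rfl, rfl, rfl⟩

/-- The number of values of `f` less than `k`. -/
def countLT (f : Fin m → Fin n) (k : ℕ) : ℕ :=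
  (Finset.univ.filter fun i => (f i).val < k).card

theorem countLT_zero (f : Fin m → Fin n) : countLT f 0 = 0 := by simp [countLT]

theorem countLT_last (f : Fin m → Fin n) : countLT f n = m := by simp [countLT]

theorem countLT_apply {f : Fin m → Fin n} (hf : StrictMono f) (i : Fin m) :
    countLT f (f i) = i := by
  have : (Finset.univ.filter fun k => (f k).val < (f i).val) = Finset.Iio i := by
    ext k
    simp [hf.lt_iff_lt]
  rw [countLT, this, Fin.card_Iio]

theorem countLT_apply_succ {f : Fin m → Fin n} (hf : StrictMono f) (i : Fin m) :
    countLT f ((f i).val + 1) = i + 1 := by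
  have : (Finset.univ.filter fun k => (f k).val < (f i).val + 1) = Finset.Iic i := by
    ext k
    simp [hf.le_iff_le]
  rw [countLT, this, Fin.card_Iic]

/-- The edges on the two sides of a deleted line merge under contraction, hence get the same index;
this makes the inserted line straight. -/
theorem countLT_succ {f : Fin m → Fin n} {a : Fin n} (ha : a ∉ Set.range f) :
    countLT f (a.val + 1) = countLT f a := by
  unfold countLT
  congr 1
  ext k
  have : (f k).val ≠ a.val := fun h => ha ⟨k, Fin.ext h⟩
  simp only [Finset.mem_filter, Finset.mem_univ, true_and]
  omega

open Classical in
/-- The strands on the horizontal edges of column `b` after the insertion of the hooks. -/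
noncomputable def colEdgeInsert (w : Equiv.Perm (Fin n)) (s : Fin m ↪o Fin n) (C : Tiling m m)
    (a : ℕ) (b : Fin n) : Bool :=
  if h : ∃ j, sortedEntries (subword w s) j = b then colEdge C (countLT s a) h.choose
  else decide ((w.symm b).val < a)

open Classical in
/-- The strands on the vertical edges of row `a` after the insertion of the hooks. -/
noncomputable def rowEdgeInsert (w : Equiv.Perm (Fin n)) (s : Fin m ↪o Fin n) (C : Tiling m m)
    (a : Fin n) (b : ℕ) : Bool :=
  if h : ∃ i, s i = a then rowEdge C h.choose (countLT (sortedEntries (subword w s)) b)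
  else decide ((w a).val < b)

variable (w : Equiv.Perm (Fin n)) (s : Fin m ↪o Fin n) (C : Tiling m m)

theorem colEdgeInsert_apply (a : ℕ) (j : Fin m) :
    colEdgeInsert w s C a (sortedEntries (subword w s) j) = colEdge C (countLT s a) j := by
  have h : ∃ j', sortedEntries (subword w s) j' = sortedEntries (subword w s) j := ⟨j, rfl⟩
  rw [colEdgeInsert, dif_pos h, (sortedEntries_strictMono w s).injective h.choose_spec]

theorem colEdgeInsert_hook (a : ℕ) {x : Fin n} (hx : x ∉ Set.range s) :
    colEdgeInsert w s C a (w x) = decide (x.val < a) := by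
  rw [colEdgeInsert, dif_neg (fun ⟨j, hj⟩ => sortedEntries_ne hx j hj), Equiv.symm_apply_apply]

theorem rowEdgeInsert_apply (i : Fin m) (b : ℕ) :
    rowEdgeInsert w s C (s i) b =
      rowEdge C i (countLT (sortedEntries (subword w s)) b) := by
  have h : ∃ i', s i' = s i := ⟨i, rfl⟩
  rw [rowEdgeInsert, dif_pos h, s.injective h.choose_spec]

theorem rowEdgeInsert_hook {x : Fin n} (hx : x ∉ Set.range s) (b : ℕ) :
    rowEdgeInsert w s C x b = decide ((w x).val < b) := by
  rw [rowEdgeInsert, dif_neg (fun ⟨j, hj⟩ => hx ⟨j, hj⟩)]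

theorem colEdgeInsert_succ {a b : Fin n} (ha : a ∉ Set.range s) (hb : b ≠ w a) :
    colEdgeInsert w s C (a + 1) b = colEdgeInsert w s C a b := by
  by_cases h : b ∈ Set.range (sortedEntries (subword w s))
  · obtain ⟨j, rfl⟩ := h
    rw [colEdgeInsert_apply, colEdgeInsert_apply, countLT_succ ha]
  · obtain ⟨x, hx, rfl⟩ := exists_of_notMem_range h
    rw [colEdgeInsert_hook w s C _ hx, colEdgeInsert_hook w s C _ hx]
    have : x.val ≠ a.val := fun e => hb (by rw [Fin.ext e])
    rw [decide_eq_decide]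
    omega

theorem colEdgeInsert_hook_succ {a x : Fin n} (hx : x ∉ Set.range s) (ha : a ≠ x) :
    colEdgeInsert w s C (a + 1) (w x) = colEdgeInsert w s C a (w x) := by
  rw [colEdgeInsert_hook w s C _ hx, colEdgeInsert_hook w s C _ hx, decide_eq_decide]
  rw [Ne, Fin.ext_iff] at ha
  omega

theorem rowEdgeInsert_hook_succ {a b : Fin n} (ha : a ∉ Set.range s) (hb : b ≠ w a) :
    rowEdgeInsert w s C a (b + 1) = rowEdgeInsert w s C a b := by
  rw [rowEdgeInsert_hook w s C ha, rowEdgeInsert_hook w s C ha, decide_eq_decide]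
  rw [Ne, Fin.ext_iff] at hb
  omega

theorem rowEdgeInsert_succ {a x : Fin n} (hx : x ∉ Set.range s) (ha : a ≠ x) :
    rowEdgeInsert w s C a (w x + 1) = rowEdgeInsert w s C a (w x) := by
  by_cases h : a ∈ Set.range s
  · obtain ⟨i, rfl⟩ := h
    rw [rowEdgeInsert_apply, rowEdgeInsert_apply, countLT_succ]
    rintro ⟨j, hj⟩
    exact sortedEntries_ne hx j hj
  · exact rowEdgeInsert_hook_succ w s C h fun e => ha (w.injective e.symm)

theorem Tile.ne_elbow_of_north_eq {T : Tile} (h : T.south = T.north) :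
    T ≠ .rElbow ∧ T ≠ .jElbow := by
  cases T <;> simp_all [Tile.south, Tile.north]

variable {C}

/-- Hooks can be inserted into every bumpless pipe dream. -/
theorem IsBPD.exists_hooked (hC : IsBPD C) :
    ∃ B : Tiling n n, IsBPD B ∧ Hooked w s B ∧
      ∀ a b, C a b = B (s a) (sortedEntries (subword w s) b) := by
  have hs := s.strictMono
  have ht := sortedEntries_strictMono w s
  obtain ⟨B, hB, hE⟩ := exists_isBPD_of_edges (colEdgeInsert w s C) (rowEdgeInsert w s C)
    (fun b => by
      by_cases h : b ∈ Set.range (sortedEntries (subword w s))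
      · obtain ⟨j, rfl⟩ := h
        rw [colEdgeInsert_apply, countLT_zero, colEdge]
      · obtain ⟨x, hx, rfl⟩ := exists_of_notMem_range h
        simp [colEdgeInsert_hook w s C _ hx])
    (fun b => by
      by_cases h : b ∈ Set.range (sortedEntries (subword w s))
      · obtain ⟨j, rfl⟩ := h
        rw [colEdgeInsert_apply, countLT_last, (hC.edges_last j).1]
      · obtain ⟨x, hx, rfl⟩ := exists_of_notMem_range h
        simp [colEdgeInsert_hook w s C _ hx])
    (fun a => by
      by_cases h : a ∈ Set.range s
      · obtain ⟨i, rfl⟩ := h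
        rw [rowEdgeInsert_apply, countLT_zero, rowEdge]
      · simp [rowEdgeInsert_hook w s C h])
    (fun a => by
      by_cases h : a ∈ Set.range s
      · obtain ⟨i, rfl⟩ := h
        rw [rowEdgeInsert_apply, countLT_last, (hC.edges_last i).2]
      · simp [rowEdgeInsert_hook w s C h])
    -- A cell is either kept, with the sides of the tile of `C`, or the corner of a hook, an
    -- r-elbow, or in another place of a deleted row or column, where opposite sides agree and the
    -- tile is straight.
    (fun a b => by
      by_cases ha : a ∈ Set.range s
      · by_cases hb : b ∈ Set.range (sortedEntries (subword w s))
        · obtain ⟨i, rfl⟩ := ha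
          obtain ⟨j, rfl⟩ := hb
          refine ⟨C i j, ?_⟩
          rw [colEdgeInsert_apply, colEdgeInsert_apply, rowEdgeInsert_apply, rowEdgeInsert_apply,
            countLT_apply hs, countLT_apply_succ hs, countLT_apply ht, countLT_apply_succ ht]
          exact hC.edges i j
        · obtain ⟨x, hx, rfl⟩ := exists_of_notMem_range hb
          have hax : a ≠ x := fun e => hx (e ▸ ha)
          rw [colEdgeInsert_hook_succ w s C hx hax, rowEdgeInsert_succ w s C hx hax]
          exact Tile.exists_straight _ _
      · by_cases hb : b = w a
        · subst hb
          refine ⟨.rElbow, ?_⟩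
          simp [colEdgeInsert_hook w s C _ ha, rowEdgeInsert_hook w s C ha, Tile.north,
            Tile.south, Tile.east, Tile.west]
        · rw [colEdgeInsert_succ w s C ha hb, rowEdgeInsert_hook_succ w s C ha hb]
          exact Tile.exists_straight _ _)
  refine ⟨B, hB, ⟨fun x hx => ?_, fun x hx b hb => ?_, fun x hx a ha => ?_⟩, fun i j => ?_⟩
  · obtain ⟨h1, h2, h3, h4⟩ := hE x (w x)
    apply Tile.ext_sides
    · rw [h1, colEdgeInsert_hook w s C _ hx]; simp [Tile.north]
    · rw [h2, colEdgeInsert_hook w s C _ hx]; simp [Tile.south]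
    · rw [h4, rowEdgeInsert_hook w s C hx]; simp [Tile.east]
    · rw [h3, rowEdgeInsert_hook w s C hx]; simp [Tile.west]
  · apply Tile.ne_elbow_of_north_eq
    rw [(hE x b).1, (hE x b).2.1, colEdgeInsert_succ w s C hx hb]
  · apply Tile.ne_elbow_of_north_eq
    rw [(hE a (w x)).1, (hE a (w x)).2.1, colEdgeInsert_hook_succ w s C hx ha]
  · obtain ⟨h1, h2, h3, h4⟩ := hE (s i) (sortedEntries (subword w s) j)
    obtain ⟨g1, g2, g3, g4⟩ := hC.edges i j
    rw [colEdgeInsert_apply, countLT_apply hs] at h1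
    rw [colEdgeInsert_apply, countLT_apply_succ hs] at h2
    rw [rowEdgeInsert_apply, countLT_apply ht] at h3
    rw [rowEdgeInsert_apply, countLT_apply_succ ht] at h4
    exact Tile.ext_sides (g1.trans h1.symm) (g2.trans h2.symm) (g4.trans h4.symm)
      (g3.trans h3.symm)

end Insertion

/-! ### The bijection. -/

theorem bijOn_phi {n m : ℕ} (w : Equiv.Perm (Fin n)) (s : Fin m ↪o Fin n)
    (hw : Avoids w perm1243) :
    Set.BijOn (phi w s) (bpdsub w s) (mbpd (perm (subword w s))) := by
  refine ⟨fun B hB => ?_, fun B hB B' hB' h => ?_, fun C hC => ?_⟩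
  · have hH := Hooked.of_mem_BPDsub hB.1
    have hB₁ := hB.1.1
    exact ⟨(hH.mem_BPD_iff hB₁.1 hH.phi_apply).2 hB₁,
      (hH.isMinimal_iff hB₁ hH.phi_apply).2 hB.1,
      hH.isReduced_of_isReduced hB₁.1 hH.phi_apply hB.2⟩
  · have hH := Hooked.of_mem_BPDsub hB.1
    have hH' := Hooked.of_mem_BPDsub hB'.1
    refine hH.eq_of_submatrix_eq hH' hB.1.1.1 hB'.1.1.1 fun a b => ?_
    rw [← hH.phi_apply, ← hH'.phi_apply, h]
  -- Surjectivity is the one place where avoidance of `1243` is needed: it makes the tiling with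
  -- inserted hooks reduced.
  · obtain ⟨hCu, hmin, hred⟩ := hC
    obtain ⟨B, hB, hH, hCB⟩ := hCu.1.exists_hooked w s
    have hBw := (hH.mem_BPD_iff hB hCB).1 hCu
    refine ⟨B, ⟨(hH.isMinimal_iff hBw hCB).1 hmin, hH.isReduced hBw hw hCB hred⟩, ?_⟩
    funext a b
    rw [hH.phi_apply, hCB]

end BumplessPipeDream

theorem mainTheorem6 {n m : ℕ} (w : Equiv.Perm (Fin n)) (s : Fin m ↪o Fin n)
    (hw : BumplessPipeDream.Avoids w BumplessPipeDream.perm1243) :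
    BumplessPipeDream.phi w s '' BumplessPipeDream.bpdsub w s =
        BumplessPipeDream.mbpd (BumplessPipeDream.perm (BumplessPipeDream.subword w s)) ∧
      Set.BijOn (BumplessPipeDream.phi w s) (BumplessPipeDream.bpdsub w s)
        (BumplessPipeDream.mbpd (BumplessPipeDream.perm (BumplessPipeDream.subword w s))) :=
  ⟨(BumplessPipeDream.bijOn_phi w s hw).image_eq, BumplessPipeDream.bijOn_phi w s hw⟩
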